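/- Let $T$ be the number of targets, let the instance space $X$ be a standard Borel space (for example the set of defender mixed strategies $\{x\in[0,1]^T : \sum_i x_i\le K\}$), and let the outcome space be $Y=\{t_1,\dots,t_T\}$, where $t_i$ means that target $i$ is attacked. For $a\in\mathbb{R}^{T-1}$ put $a_T=0$ and define the loss $$l(t_i,a)=-\log\frac{e^{a_i}}{1+\sum_{j=1}^{T-1}e^{a_j}},\qquad \rho(a,b)=\max_{y\in Y}|l(y,a)-l(y,b)|,\qquad \bar d_{l_1}(a,b)=\frac1{T-1}\sum_{i=1}^{T-1}|a_i-b_i|$$ (with $\bar d_{l_1}=0$ if $T=1$). Let $M>0$ and let $\mathcal H$ be a class of functions $h:X\to[-\frac M2,\frac M2]^{T-1}$ that is permissible in Pollard's sense: $\mathcal H=\{h_t : t\in I\}$ for an analytic subset $I$ of a compact metric space such that $(x,t)\mapsto h_t(x)$ is jointly measurable. For a probability measure $p$ on $X\times Y$ and a sample $\vec z=((x_1,y_1),\dots,(x_m,y_m))$ of $m$ independent draws from $p$, let $r_h(p)=\mathbb{E}_{p}\,l(y,h(x))$ and $\hat r_h(\vec z)=\frac1m\sum_{i=1}^m l(y_i,h(x_i))$.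 An algorithm is a map $\mathcal A$ from samples of size $m$ to $\mathcal H$; it is an ERM algorithm if $\hat r_{\mathcal A(\vec z)}(\vec z)=\inf_{h\in\mathcal H}\hat r_h(\vec z)$ for every $\vec z$. Consider the two conditions $$\text{(i)}\ \Pr\Big(\forall h\in\mathcal H:\ |\hat r_h(\vec z)-r_h(p)|<\tfrac\alpha3\Big)>1-\tfrac\delta2,\qquad \text{(ii)}\ \Pr\Big(\big|\hat r_{\mathcal A(\vec z)}(\vec z)-\inf_{h\in\mathcal H}\hat r_h(\vec z)\big|<\tfrac\alpha3\Big)>1-\tfrac\delta2 .$$ The class $\mathcal H$ is called $(\alpha,\delta)$-PAC learnable from $m$ samples of $p$ if (i) and (ii) hold for some ERM algorithm $\mathcal A$. (For an event that is not known to be measurable, $\Pr(E)>c$ means that $E$ contains a measurable event of probability greater than $c$.) The capacity $\mathcal C(\epsilon,\mathcal H,d)$ is the supremum, over all probability measures $P$ on $X$, of the least size of a finite set $\mathcal F\subseteq\mathcal H$ such that every $h\in\mathcal H$ has an $f\in\mathcal F$ with $\int_X d(f(x),h(x))\,dP(x)\le\epsilon$. Then: 1. $\rho(a,b)\le 2\max_i|a_i-b_i|\le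 2T\,\bar d_{l_1}(a,b)$ for all $a,b\in\mathbb{R}^{T-1}$. 2. Let $\alpha>0$ and $0<\delta<1$, suppose that $\mathcal C(\frac{\alpha}{96T},\mathcal H,\bar d_{l_1})$ is finite, and let $$m\ \ge\ \frac{576M^2}{\alpha^2}\Big(\log\frac1\delta+\log\big(8\,\mathcal C(\tfrac{\alpha}{96T},\mathcal H,\bar d_{l_1})\big)\Big).$$ Then for every probability measure $p$ on $X\times Y$: condition (i) holds; every ERM algorithm satisfies (ii); every algorithm $\mathcal A$ that satisfies (ii) (in particular every ERM algorithm) satisfies $$\Pr\Big(\big|r_{\mathcal A(\vec z)}(p)-\inf_{h\in\mathcal H}r_h(p)\big|<\alpha\Big)>1-\delta ;$$ and if an ERM algorithm exists, then $\mathcal H$ is $(\alpha,\delta)$-PAC learnable from $m$ samples of $p$. -/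

import Mathlib

open MeasureTheory

noncomputable section

namespace SecurityGame

/-- The log-odds vector `a ∈ ℝ^(T-1)` extended by the reference value `a_T = 0`. -/
def extend {T : ℕ} (a : Fin (T - 1) → ℝ) (i : Fin T) : ℝ :=
  if hi : (i : ℕ) < T - 1 then a ⟨i, hi⟩ else 0

/-- The softmax log-likelihood loss `l(t_i, a) = -log (e^{a_i} / (1 + ∑_{j<T} e^{a_j}))`,
with `a_T = 0`; the outcome `t_i` (target `i` is attacked) is represented by its index `i`. -/
def loss {T : ℕ} (i : Fin T) (a : Fin (T - 1) → ℝ) : ℝ :=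
  -Real.log (Real.exp (extend a i) / (1 + ∑ j : Fin (T - 1), Real.exp (a j)))

/-- The pseudometric induced by the loss, `ρ(a, b) = max_y |l(y, a) - l(y, b)|`. -/
def rho (T : ℕ) (a b : Fin (T - 1) → ℝ) : ℝ :=
  ⨆ y : Fin T, |loss y a - loss y b|

/-- The average `l₁` distance on `ℝ^n`. -/
def avgL1 {n : ℕ} (a b : Fin n → ℝ) : ℝ :=
  (∑ i, |a i - b i|) / n

/-- The distance `d_{L¹(P,d)}(f, g) = ∫ d(f x, g x) dP(x)`. -/
def distL1 {X A : Type*} [MeasurableSpace X] (P : Measure X) (d : A → A → ℝ) (f g : X → A) : ℝ :=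
  ∫ x, d (f x) (g x) ∂P

/-- `F` is a (finite, proper) `ε`-cover of `H` for the distance `d`. -/
def IsCover {B : Type*} (ε : ℝ) (H : Set B) (d : B → B → ℝ) (F : Finset B) : Prop :=
  (F : Set B) ⊆ H ∧ ∀ h ∈ H, ∃ f ∈ F, d f h ≤ ε

/-- The size of the smallest `ε`-cover (`⊤` if there is none). -/
def coveringNumber {B : Type*} (ε : ℝ) (H : Set B) (d : B → B → ℝ) : ℕ∞ :=
  ⨅ (F : Finset B) (_ : IsCover ε H d F), (F.card : ℕ∞)

/-- The capacity `C(ε, H, d) = sup_P N(ε, H, d_{L¹(P,d)})`, over all probability measures `P`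
on the instance space. -/
def capacity {X A : Type*} [MeasurableSpace X] (ε : ℝ) (H : Set (X → A)) (d : A → A → ℝ) : ℕ∞ :=
  ⨆ P : ProbabilityMeasure X, coveringNumber ε H (distL1 (P : Measure X) d)

/-- Permissible classes in the sense of Pollard: `H` can be indexed by an analytic subset `I` of a
compact metric space so that `(x, t) ↦ h_t(x)` is jointly measurable (`I` carrying its Borel
σ-algebra). -/
def Permissible {X A : Type*} [MeasurableSpace X] [MeasurableSpace A] (H : Set (X → A)) : Prop :=
  ∃ (S : Type) (_ : MetricSpace S) (_ : CompactSpace S) (_ : MeasurableSpace S) (_ : BorelSpace S)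
    (I : Set S) (f : X × I → A),
    AnalyticSet I ∧ Measurable f ∧ H = Set.range (fun (t : I) (x : X) => f (x, t))

/-- The true risk `r_h(p) = E_p [l(y, h(x))]`. -/
def trueRisk {X : Type*} [MeasurableSpace X] {T : ℕ} (p : Measure (X × Fin T))
    (h : X → Fin (T - 1) → ℝ) : ℝ :=
  ∫ z, loss z.2 (h z.1) ∂p

/-- The empirical risk of `h` on the sample `z`. -/
def empRisk {X : Type*} {T m : ℕ} (z : Fin m → X × Fin T) (h : X → Fin (T - 1) → ℝ) : ℝ :=
  (1 / (m : ℝ)) * ∑ i, loss (z i).2 (h (z i).1)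

/-- The event `E` has probability greater than `c`. As `E` may depend on an arbitrary algorithm, it
need not be measurable; then it is required to contain a measurable event of probability greater
than `c`. For measurable `E` this just says `μ E > c`. -/
def ProbGT {Ω : Type*} [MeasurableSpace Ω] (μ : Measure Ω) (E : Set Ω) (c : ℝ) : Prop :=
  ∃ G, MeasurableSet G ∧ G ⊆ E ∧ ENNReal.ofReal c < μ G

/-- The law of `m` independent draws from `p`. -/
def sampleLaw {X : Type*} [MeasurableSpace X] {T : ℕ} (p : Measure (X × Fin T)) (m : ℕ) :
    Measure (Fin m → X × Fin T) :=
  Measure.pi (fun _ => p)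

/-- First condition of PAC learnability:
`Pr(∀ h ∈ H, |r̂_h(z) - r_h(p)| < α/3) > 1 - δ/2`. -/
def UniformConvergence {X : Type*} [MeasurableSpace X] {T : ℕ} (H : Set (X → Fin (T - 1) → ℝ))
    (p : Measure (X × Fin T)) (m : ℕ) (α δ : ℝ) : Prop :=
  ProbGT (sampleLaw p m) {z | ∀ h ∈ H, |empRisk z h - trueRisk p h| < α / 3} (1 - δ / 2)

/-- A learning algorithm for samples of size `m`. -/
abbrev Algorithm (X : Type*) (T m : ℕ) : Type _ :=
  (Fin m → X × Fin T) → (X → Fin (T - 1) → ℝ)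

/-- An (exact) empirical risk minimizing algorithm: it outputs members of `H` whose empirical risk
is the least one in `H`. -/
def IsERM {X : Type*} {T m : ℕ} (H : Set (X → Fin (T - 1) → ℝ)) (alg : Algorithm X T m) : Prop :=
  ∀ z, alg z ∈ H ∧ empRisk z (alg z) = sInf (empRisk z '' H)

/-- Second condition of PAC learnability, for an algorithm with outputs in `H`:
`Pr(|r̂_{alg(z)}(z) - inf_{h ∈ H} r̂_h(z)| < α/3) > 1 - δ/2`. -/
def IsApproxERM {X : Type*} [MeasurableSpace X] {T m : ℕ} (H : Set (X → Fin (T - 1) → ℝ))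
    (p : Measure (X × Fin T)) (α δ : ℝ) (alg : Algorithm X T m) : Prop :=
  (∀ z, alg z ∈ H) ∧
    ProbGT (sampleLaw p m) {z | |empRisk z (alg z) - sInf (empRisk z '' H)| < α / 3} (1 - δ / 2)

/-- The PAC guarantee:
`Pr(|r_{alg(z)}(p) - inf_{h ∈ H} r_h(p)| < α) > 1 - δ`. -/
def PACGuarantee {X : Type*} [MeasurableSpace X] {T m : ℕ} (H : Set (X → Fin (T - 1) → ℝ))
    (p : Measure (X × Fin T)) (α δ : ℝ) (alg : Algorithm X T m) : Prop :=
  ProbGT (sampleLaw p m) {z | |trueRisk p (alg z) - sInf (trueRisk p '' H)| < α} (1 - δ)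

/-- `H` is `(α, δ)`-PAC learnable from `m` samples drawn from `p`: there is an ERM algorithm such
that both conditions hold. -/
def PACLearnable {X : Type*} [MeasurableSpace X] {T : ℕ} (H : Set (X → Fin (T - 1) → ℝ))
    (p : Measure (X × Fin T)) (m : ℕ) (α δ : ℝ) : Prop :=
  ∃ alg : Algorithm X T m,
    IsERM H alg ∧ UniformConvergence H p m α δ ∧ IsApproxERM H p α δ alg

end SecurityGame

end

/-!
The core is Pollard's and Haussler's uniform law of large numbers,
`measure_pi_exists_abs_average_sub_integral_ge_le`. Put `ε = α / 3`. By Chebyshev, a sample on which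
some `h ∈ H` has empirical risk at distance `ε` from its mean is, with probability at least `1/2`
over an independent ghost sample, also at distance `ε / 2` from the empirical risk on the ghost
sample. This costs a factor `2` and removes the true risk. The law of the two samples is invariant
under exchanging the members of any of the `m` pairs, so it suffices to bound, for each fixed double
sample, the proportion of the `2 ^ m` exchanges with a large deviation. On the fixed double sample
the capacity bound, applied to its empirical measure, gives a cover by `C` hypotheses which changes
averages of the losses by at most `ε / 8`, and Hoeffding's inequality for Rademacher sums handles
each member of the cover. The result is the bound `4 C exp (-m (3 ε / 8)² / (2 R²))`, where `R`
is the length of the range of the loss.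

The loss is log-sum-exp minus a coordinate, hence `2`-Lipschitz for the sup distance, and on the
box `[-M/2, M/2]^(T-1)` its range has length at most `R = 2 M`. The exponent becomes
`m α² / (512 M²)`, and the assumed lower bound for `m` makes the probability less than `δ / 2`.

The deviation events are uncountable unions. In the symmetrization step outer measure suffices, but
averaging over exchanges needs measurability. There permissibility enters: the event for the double
sample is the projection of a measurable set along the index space `ℕ → ℕ`, so it is analytic, and
analytic sets are approximated from inside by compact sets (`AnalyticSet.exists_measurableSet_lt`).

Given uniform convergence, the PAC guarantee is the three-term comparison
`abs_sub_sInf_image_lt`.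
-/

open MeasureTheory

/-! ### Inner regularity of analytic sets -/

open Set Filter Topology in
/-- Analytic sets are inner regular for finite measures, hence universally measurable. Write the set
as `f '' (ℕ → ℕ)` with `f` continuous; continuity from below of the outer measure allows bounding
the coordinates one after the other with an arbitrarily small total loss of mass, and the
resulting box in `ℕ → ℕ` is compact. -/
theorem MeasureTheory.AnalyticSet.exists_measurableSet_lt {α : Type*} [TopologicalSpace α]
    [PolishSpace α] [MeasurableSpace α] [BorelSpace α] {s : Set α} (hs : AnalyticSet s)
    (μ : Measure α) [IsFiniteMeasure μ] {r : ENNReal} (hr : r < μ s) :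
    ∃ K ⊆ s, MeasurableSet K ∧ r < μ K := by
  rw [AnalyticSet] at hs
  obtain rfl | ⟨f, hf, rfl⟩ := hs
  · simp at hr
  obtain ⟨q, hrq, hq⟩ := exists_between hr
  have step : ∀ (A : Set (ℕ → ℕ)) (k : ℕ), ∃ j : ℕ,
      q < μ (f '' A) → q < μ (f '' (A ∩ {x | x k ≤ j})) := by
    intro A k
    by_cases hA : q < μ (f '' A)
    · have hmono : Monotone fun j : ℕ => f '' (A ∩ {x | x k ≤ j}) := fun i j hij =>
        image_mono (inter_subset_inter_right _ fun x (hx : x k ≤ i) => hx.trans hij)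
      have hU : f '' A = ⋃ j : ℕ, f '' (A ∩ {x | x k ≤ j}) := by
        rw [← image_iUnion, ← inter_iUnion]
        congr 1
        ext x
        simpa using fun _ => ⟨x k, le_rfl⟩
      rw [hU, hmono.measure_iUnion] at hA
      obtain ⟨j, hj⟩ := lt_iSup_iff.1 hA
      exact ⟨j, fun _ => hj⟩
    · exact ⟨0, fun h => absurd h hA⟩
  choose j hj using step
  let A : ℕ → Set (ℕ → ℕ) := fun k => Nat.rec univ (fun k A => A ∩ {x | x k ≤ j A k}) k
  have hA : ∀ k, q < μ (f '' A k) := by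
    intro k
    induction k with
    | zero => simpa [A, image_univ] using hq
    | succ k ih => exact hj _ k ih
  let n : ℕ → ℕ := fun k => j (A k) k
  have hAn : ∀ k, ∀ x ∈ A k, ∀ i < k, x i ≤ n i := by
    intro k
    induction k with
    | zero => intro x _ i hi; omega
    | succ k ih =>
      intro x hx i hi
      rcases Nat.lt_succ_iff_lt_or_eq.1 hi with h | rfl
      · exact ih x hx.1 i h
      · exact hx.2
  have compact_box : ∀ c : ℕ → ℕ, IsCompact (univ.pi fun i => Iic (c i)) := fun c =>
    isCompact_univ_pi fun i => (finite_Iic (c i)).isCompact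
  let K : Set (ℕ → ℕ) := univ.pi fun i => Iic (n i)
  have hK : IsCompact (f '' K) := (compact_box n).image hf
  refine ⟨f '' K, image_subset_range _ _, hK.measurableSet, hrq.trans_le ?_⟩
  let _ := TopologicalSpace.upgradeIsCompletelyMetrizable α
  rw [(f '' K).measure_eq_iInf_isOpen μ]
  refine le_iInf₂ fun U hKU => le_iInf fun hU => ?_
  suffices ∃ k, A k ⊆ f ⁻¹' U by
    obtain ⟨k, hk⟩ := this
    exact (hA k).le.trans (measure_mono (image_subset_iff.2 hk))
  by_contra! hcon
  -- Points of `A k` outside `f ⁻¹' U` all lie in one compact box, so they accumulate at a point,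
  -- which is in `K` as its `i`-th coordinate is bounded by `n i` from the index `i + 1` on.
  simp only [not_subset] at hcon
  choose x hxA hxU using hcon
  let c : ℕ → ℕ := fun i => n i + ∑ k ∈ Finset.range (i + 1), x k i
  have hxc : ∀ k, x k ∈ univ.pi fun i => Iic (c i) := by
    intro k i _
    by_cases hi : i < k
    · exact (hAn k _ (hxA k) i hi).trans (Nat.le_add_right _ _)
    · refine le_trans ?_ (Nat.le_add_left _ _)
      exact Finset.single_le_sum (f := fun k => x k i) (fun _ _ => Nat.zero_le _)
        (Finset.mem_range.2 (by omega))
  obtain ⟨y, -, φ, hφ, hy⟩ := (compact_box c).tendsto_subseq hxc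
  have hyK : y ∈ K := by
    intro i _
    refine le_of_tendsto ((tendsto_pi_nhds.1 hy) i) ?_
    filter_upwards [hφ.tendsto_atTop.eventually_gt_atTop i] with k hk
    exact hAn _ _ (hxA _) i hk
  have hyU : y ∈ f ⁻¹' U := hKU (mem_image_of_mem f hyK)
  obtain ⟨k, hk⟩ := (hy.eventually ((hU.preimage hf).mem_nhds hyU)).exists
  exact hxU _ hk

/-- An uncountable union of sections of a measurable set can be approximated in measure from inside
by measurable sets. This is how permissibility of a class enters. -/
theorem MeasurableSet.exists_measurableSet_lt_image_fst {W U : Type*} [MeasurableSpace W]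
    [StandardBorelSpace W] [MeasurableSpace U] [StandardBorelSpace U] {S : Set (W × U)}
    (hS : MeasurableSet S) (μ : Measure W) [IsFiniteMeasure μ] {r : ENNReal}
    (hr : r < μ (Prod.fst '' S)) :
    ∃ K ⊆ Prod.fst '' S, MeasurableSet K ∧ r < μ K := by
  let _ := upgradeStandardBorel W
  let _ := upgradeStandardBorel U
  exact (hS.analyticSet.image_of_continuous continuous_fst).exists_measurableSet_lt μ hr

/-! ### Rademacher sums -/

/-- The value `1` or `-1` of a Rademacher sign encoded by a Boolean. -/
def rademacherSign (b : Bool) : ℝ := if b then -1 else 1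

theorem sum_exp_rademacher_le {m : ℕ} (a : Fin m → ℝ) (l : ℝ) :
    ∑ s : Fin m → Bool, Real.exp (l * ∑ i, rademacherSign (s i) * a i) ≤
      2 ^ m * Real.exp (l ^ 2 * (∑ i, a i ^ 2) / 2) := by
  have h1 : ∀ s : Fin m → Bool, Real.exp (l * ∑ i, rademacherSign (s i) * a i) =
      ∏ i, Real.exp (l * (rademacherSign (s i) * a i)) := fun s => by
    rw [Finset.mul_sum, Real.exp_sum]
  simp_rw [h1]
  rw [← Fintype.prod_sum (fun (i : Fin m) (b : Bool) => Real.exp (l * (rademacherSign b * a i)))]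
  calc _ ≤ ∏ i : Fin m, (2 * Real.exp ((l * a i) ^ 2 / 2)) := by
        refine Finset.prod_le_prod (fun i _ => Finset.sum_nonneg fun _ _ => (Real.exp_pos _).le)
          fun i _ => ?_
        have := Real.cosh_le_exp_half_sq (l * a i)
        rw [Real.cosh_eq] at this
        simp only [rademacherSign, Fintype.sum_bool, if_true, Bool.false_eq_true, if_false, one_mul,
          neg_mul, mul_neg]
        linarith
    _ = _ := by
        rw [Finset.prod_mul_distrib, Finset.prod_const, Finset.card_univ, Fintype.card_fin,
          ← Real.exp_sum, Finset.mul_sum, Finset.sum_div]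
        simp_rw [mul_pow]

theorem card_le_rademacher_sum_le {m : ℕ} {R : ℝ} (hR : 0 < R) {a : Fin m → ℝ}
    (ha : ∀ i, |a i| ≤ R) {t : ℝ} (ht : 0 ≤ t) :
    (Finset.card {s : Fin m → Bool | m * t ≤ ∑ i, rademacherSign (s i) * a i} : ℝ) ≤
      2 ^ m * Real.exp (-(m * t ^ 2 / (2 * R ^ 2))) := by
  -- Markov's inequality for `exp (l * ∑ ± a i)` at the optimal `l`.
  set l := t / R ^ 2 with hl
  have hl0 : 0 ≤ l := by positivity
  have hsq : ∑ i, a i ^ 2 ≤ m * R ^ 2 := by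
    calc ∑ i, a i ^ 2 ≤ ∑ _i : Fin m, R ^ 2 :=
          Finset.sum_le_sum fun i _ => sq_le_sq' (abs_le.1 (ha i)).1 (abs_le.1 (ha i)).2
      _ = _ := by simp
  have h1 : (Finset.card {s : Fin m → Bool | m * t ≤ ∑ i, rademacherSign (s i) * a i} : ℝ) *
      Real.exp (l * (m * t)) ≤ 2 ^ m * Real.exp (l ^ 2 * (m * R ^ 2) / 2) := by
    calc _ = ∑ s : Fin m → Bool with m * t ≤ ∑ i, rademacherSign (s i) * a i,
            Real.exp (l * (m * t)) := by simp
      _ ≤ ∑ s : Fin m → Bool with m * t ≤ ∑ i, rademacherSign (s i) * a i,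
            Real.exp (l * ∑ i, rademacherSign (s i) * a i) := by
          refine Finset.sum_le_sum fun s hs => ?_
          have := (Finset.mem_filter.1 hs).2
          gcongr
      _ ≤ ∑ s : Fin m → Bool, Real.exp (l * ∑ i, rademacherSign (s i) * a i) :=
          Finset.sum_le_sum_of_subset_of_nonneg (Finset.filter_subset _ _)
            fun _ _ _ => (Real.exp_pos _).le
      _ ≤ _ := sum_exp_rademacher_le a l
      _ ≤ _ := by gcongr
  have h2 : -(m * t ^ 2 / (2 * R ^ 2)) = l ^ 2 * (m * R ^ 2) / 2 - l * (m * t) := by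
    rw [hl]; field_simp; ring
  rw [h2, Real.exp_sub, ← mul_div_assoc, le_div_iff₀ (Real.exp_pos _)]
  exact h1

/-- Hoeffding's inequality for a Rademacher sum, as a count of sign patterns. -/
theorem card_le_abs_rademacher_sum_le {m : ℕ} {R : ℝ} (hR : 0 < R) {a : Fin m → ℝ}
    (ha : ∀ i, |a i| ≤ R) {t : ℝ} (ht : 0 ≤ t) :
    (Finset.card {s : Fin m → Bool | m * t ≤ |∑ i, rademacherSign (s i) * a i|} : ℝ) ≤
      2 ^ m * (2 * Real.exp (-(m * t ^ 2 / (2 * R ^ 2)))) := by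
  have h1 := card_le_rademacher_sum_le hR ha ht
  have h2 := card_le_rademacher_sum_le hR (a := fun i => -a i) (by simpa using ha) ht
  have h3 : Finset.card {s : Fin m → Bool | m * t ≤ |∑ i, rademacherSign (s i) * a i|} ≤
      Finset.card {s : Fin m → Bool | m * t ≤ ∑ i, rademacherSign (s i) * a i} +
      Finset.card {s : Fin m → Bool | m * t ≤ ∑ i, rademacherSign (s i) * -a i} := by
    refine (Finset.card_le_card ?_).trans (Finset.card_union_le _ _)
    intro s hs
    simpa [le_abs] using hs
  have h4 : (Finset.card {s : Fin m → Bool | m * t ≤ |∑ i, rademacherSign (s i) * a i|} : ℝ) ≤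
      Finset.card {s : Fin m → Bool | m * t ≤ ∑ i, rademacherSign (s i) * a i} +
      Finset.card {s : Fin m → Bool | m * t ≤ ∑ i, rademacherSign (s i) * -a i} := by
    exact_mod_cast h3
  linarith

/-! ### Exchanging the members of pairs -/

/-- Exchange the two members of those pairs `w i` for which `s i` is true. -/
def swapPairs {Z : Type*} {m : ℕ} (s : Fin m → Bool) (w : Fin m → Z × Z) : Fin m → Z × Z :=
  fun i => if s i then (w i).swap else w i

theorem measurePreserving_swapPairs {Z : Type*} [MeasurableSpace Z] (p : Measure Z)
    [IsProbabilityMeasure p] {m : ℕ} (s : Fin m → Bool) :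
    MeasurePreserving (swapPairs (Z := Z) s) (Measure.pi fun _ => p.prod p)
      (Measure.pi fun _ => p.prod p) := by
  refine measurePreserving_pi (fun _ => p.prod p) (fun _ => p.prod p)
    (f := fun i z => if s i then z.swap else z) fun i => ?_
  cases s i
  · simpa using! MeasurePreserving.id (p.prod p)
  · simpa using Measure.measurePreserving_swap

open Classical in
/-- The law of `m` independent pairs is invariant under every `swapPairs s`, so the measure of an
event is at most the largest proportion of the `2 ^ m` swaps that carry a given point into it.
Measurability of the event is essential: outer measures average in the wrong direction. -/
theorem measure_le_of_forall_card_swapPairs_le {Z : Type*} [MeasurableSpace Z] (p : Measure Z)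
    [IsProbabilityMeasure p] {m : ℕ} {A : Set (Fin m → Z × Z)} (hA : MeasurableSet A) {β : ℝ}
    (h : ∀ w, (Finset.card {s : Fin m → Bool | swapPairs s w ∈ A} : ℝ) ≤ 2 ^ m * β) :
    (Measure.pi fun _ => p.prod p) A ≤ ENNReal.ofReal β := by
  set μ : Measure (Fin m → Z × Z) := Measure.pi fun _ => p.prod p
  have hmeas : ∀ s : Fin m → Bool, MeasurableSet (swapPairs s ⁻¹' A) := fun s =>
    (measurePreserving_swapPairs p s).measurable hA
  have h1 : (2 : ENNReal) ^ m * μ A =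
      ∫⁻ w, ∑ s : Fin m → Bool, (swapPairs s ⁻¹' A).indicator 1 w ∂μ := by
    rw [lintegral_finsetSum _ fun s _ => measurable_one.indicator (hmeas s)]
    have h0 : ∀ s : Fin m → Bool, ∫⁻ w, (swapPairs s ⁻¹' A).indicator 1 w ∂μ = μ A := fun s => by
      rw [lintegral_indicator_one (hmeas s),
        (measurePreserving_swapPairs p s).measure_preimage hA.nullMeasurableSet]
    simp [h0]
  have h2 : (2 : ENNReal) ^ m * μ A ≤ 2 ^ m * ENNReal.ofReal β := by
    rw [h1]
    calc _ ≤ ∫⁻ _, ENNReal.ofReal (2 ^ m * β) ∂μ := by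
          refine lintegral_mono fun w => ?_
          refine le_trans (le_of_eq ?_) (ENNReal.ofReal_le_ofReal (h w))
          rw [ENNReal.ofReal_natCast, Finset.card_filter]
          simp [Set.indicator_apply]
      _ = _ := by
          rw [lintegral_const, measure_univ, mul_one, ENNReal.ofReal_mul (by positivity),
            ENNReal.ofReal_pow (by norm_num)]
          simp
  exact (ENNReal.mul_le_mul_iff_right (by simp) (by simp)).1 h2

/-! ### Symmetrization and the uniform law of large numbers -/

/-- Chebyshev's inequality for the empirical mean, scaled by `m`, of a function with values in an
interval of length `R`. -/
theorem measure_pi_abs_average_sub_integral_ge_le_half {Z : Type*} [MeasurableSpace Z]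
    (p : Measure Z) [IsProbabilityMeasure p] {m : ℕ} {f : Z → ℝ} (hf : Measurable f) {c R : ℝ}
    (hfR : ∀ z, f z ∈ Set.Icc c (c + R)) {t : ℝ} (ht : 0 < t) (hm : R ^ 2 ≤ 2 * (m * t ^ 2))
    (hm0 : 0 < m) :
    (Measure.pi fun _ : Fin m => p) {z | m * t ≤ |∑ i, f (z i) - m * ∫ x, f x ∂p|} ≤ 1 / 2 := by
  have hLp : MemLp f 2 p := MemLp.of_bound hf.aestronglyMeasurable (max |c| |c + R|) <|
    Filter.Eventually.of_forall fun z => by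
      rw [Real.norm_eq_abs]
      exact abs_le_max_abs_abs (hfR z).1 (hfR z).2
  have hcomp : ∀ i : Fin m, MemLp (fun z : Fin m → Z => f (z i)) 2 (Measure.pi fun _ => p) :=
    fun i => hLp.comp_measurePreserving (measurePreserving_eval (fun _ => p) i)
  have hmean : ∫ z, (∑ i : Fin m, fun z : Fin m → Z => f (z i)) z ∂(Measure.pi fun _ => p) =
      m * ∫ x, f x ∂p := by
    simp_rw [Finset.sum_apply]
    rw [integral_finsetSum _ fun i _ => (hcomp i).integrable (by norm_num)]
    have : ∀ i : Fin m, ∫ z : Fin m → Z, f (z i) ∂(Measure.pi fun _ => p) = ∫ x, f x ∂p :=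
      fun i => by
        have h := integral_map (μ := Measure.pi fun _ : Fin m => p) (φ := Function.eval i)
          (measurable_pi_apply i).aemeasurable (f := f) hf.aestronglyMeasurable
        rw [(measurePreserving_eval (fun _ : Fin m => p) i).map_eq] at h
        exact h.symm
    simp [this]
  have hvar : ProbabilityTheory.variance (∑ i : Fin m, fun z : Fin m → Z => f (z i))
      (Measure.pi fun _ => p) ≤ m * (R / 2) ^ 2 := by
    rw [ProbabilityTheory.variance_sum_pi (μ := fun _ : Fin m => p) (X := fun _ => f) fun _ => hLp]
    have := ProbabilityTheory.variance_le_sq_of_bounded (μ := p)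
      (Filter.Eventually.of_forall hfR) hf.aemeasurable
    rw [add_sub_cancel_left] at this
    simp only [Finset.sum_const, Finset.card_univ, Fintype.card_fin, nsmul_eq_mul]
    gcongr
  have hm' : (0 : ℝ) < m := by exact_mod_cast hm0
  have hcheb := ProbabilityTheory.meas_ge_le_variance_div_sq
    (memLp_finsetSum' Finset.univ fun i _ => hcomp i) (c := m * t) (by positivity)
  rw [hmean] at hcheb
  simp only [Finset.sum_apply] at hcheb
  refine hcheb.trans ?_
  rw [show (1 / 2 : ENNReal) = ENNReal.ofReal (1 / 2) by
    rw [ENNReal.ofReal_div_of_pos (by norm_num)]; simp]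
  refine ENNReal.ofReal_le_ofReal ?_
  rw [div_le_iff₀ (by positivity)]
  nlinarith

/-- Abstract symmetrization, valid for outer measure: if every fiber of `B` over `A` contains a set
of probability at least `1/2`, then `A` is at most twice as likely as `B`. -/
theorem measure_le_two_mul_of_forall_fiber {Ω : Type*} [MeasurableSpace Ω] (P : Measure Ω)
    [IsProbabilityMeasure P] {A : Set Ω} {B : Set (Ω × Ω)}
    (h : ∀ z ∈ A, ∃ G : Set Ω, 1 / 2 ≤ P G ∧ ∀ z' ∈ G, (z, z') ∈ B) :
    P A ≤ 2 * (P.prod P) B := by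
  -- Neither `A` nor `B` is assumed measurable; `D` is a measurable hull of `B`.
  set D := toMeasurable (P.prod P) B
  have hD : MeasurableSet D := measurableSet_toMeasurable _ _
  have hsub : A ⊆ {z | 1 / 2 ≤ P (Prod.mk z ⁻¹' D)} := by
    intro z hz
    obtain ⟨G, hG, hGB⟩ := h z hz
    exact hG.trans (measure_mono fun z' hz' => subset_toMeasurable _ _ (hGB z' hz'))
  have hmk : (1 / 2 : ENNReal) * P A ≤ (P.prod P) B := by
    calc (1 / 2 : ENNReal) * P A ≤ 1 / 2 * P {z | 1 / 2 ≤ P (Prod.mk z ⁻¹' D)} := by gcongr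
      _ ≤ ∫⁻ z, P (Prod.mk z ⁻¹' D) ∂P :=
          mul_meas_ge_le_lintegral (measurable_measure_prodMk_left hD) _
      _ = (P.prod P) D := (Measure.prod_apply hD).symm
      _ = (P.prod P) B := measure_toMeasurable B
  calc P A = 2 * (1 / 2 * P A) := by
        rw [← mul_assoc, one_div, ENNReal.mul_inv_cancel (by simp) (by simp), one_mul]
    _ ≤ _ := by gcongr

theorem rademacherSign_mul_sub {Z : Type*} (f : Z → ℝ) {m : ℕ} (s : Fin m → Bool)
    (w : Fin m → Z × Z) (i : Fin m) :
    f (swapPairs s w i).1 - f (swapPairs s w i).2 =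
      rademacherSign (s i) * (f (w i).1 - f (w i).2) := by
  cases h : s i <;> simp [swapPairs, rademacherSign, h]

theorem abs_rademacherSign (b : Bool) : |rademacherSign b| = 1 := by
  cases b <;> simp [rademacherSign]

open Classical in
/-- For a fixed double sample, a cover of the class in the `L¹` distance of that sample reduces the
supremum over the class to a maximum over the cover: replacing `u` by its neighbour in `F` changes
the deviation by at most `ε / 8`, and `ε / 2 - ε / 8 = 3 ε / 8`. -/
theorem card_swapPairs_exists_le {Z U : Type*} {L : Z → U → ℝ} {c R ε : ℝ} (hR : 0 < R)
    (hε : 0 < ε) (hLR : ∀ z u, L z u ∈ Set.Icc c (c + R)) {m N : ℕ} {w : Fin m → Z × Z}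
    {F : Finset U} (hFN : F.card ≤ N)
    (hF : ∀ u, ∃ v ∈ F, ∑ i, (|L (w i).1 v - L (w i).1 u| + |L (w i).2 v - L (w i).2 u|) ≤
      m * (ε / 8)) :
    (Finset.card {s : Fin m → Bool | ∃ u, m * (ε / 2) ≤
        |∑ i, (L (swapPairs s w i).1 u - L (swapPairs s w i).2 u)|} : ℝ) ≤
      2 ^ m * (N * (2 * Real.exp (-(m * (3 * ε / 8) ^ 2 / (2 * R ^ 2))))) := by
  have hsub : ({s : Fin m → Bool | ∃ u, m * (ε / 2) ≤
        |∑ i, (L (swapPairs s w i).1 u - L (swapPairs s w i).2 u)|} : Finset (Fin m → Bool)) ⊆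
      F.biUnion fun v => {s : Fin m → Bool | m * (3 * ε / 8) ≤
        |∑ i, rademacherSign (s i) * (L (w i).1 v - L (w i).2 v)|} := by
    intro s hs
    obtain ⟨u, hu⟩ := (Finset.mem_filter.1 hs).2
    obtain ⟨v, hvF, hv⟩ := hF u
    refine Finset.mem_biUnion.2 ⟨v, hvF, Finset.mem_filter.2 ⟨Finset.mem_univ _, ?_⟩⟩
    simp_rw [rademacherSign_mul_sub (fun z => L z u)] at hu
    have hdiff : |∑ i, rademacherSign (s i) * (L (w i).1 u - L (w i).2 u)| -
        |∑ i, rademacherSign (s i) * (L (w i).1 v - L (w i).2 v)| ≤ m * (ε / 8) := by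
      refine (abs_sub_abs_le_abs_sub _ _).trans ?_
      rw [← Finset.sum_sub_distrib]
      refine (Finset.abs_sum_le_sum_abs _ _).trans (le_trans ?_ hv)
      refine Finset.sum_le_sum fun i _ => ?_
      rw [← mul_sub, abs_mul, abs_rademacherSign, one_mul,
        show L (w i).1 u - L (w i).2 u - (L (w i).1 v - L (w i).2 v) =
          -(L (w i).1 v - L (w i).1 u) + (L (w i).2 v - L (w i).2 u) by ring]
      exact (abs_add_le _ _).trans_eq (by rw [abs_neg])
    linarith
  have hcard : (Finset.card {s : Fin m → Bool | ∃ u, m * (ε / 2) ≤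
        |∑ i, (L (swapPairs s w i).1 u - L (swapPairs s w i).2 u)|} : ℝ) ≤
      ∑ v ∈ F, (Finset.card {s : Fin m → Bool | m * (3 * ε / 8) ≤
        |∑ i, rademacherSign (s i) * (L (w i).1 v - L (w i).2 v)|} : ℝ) := by
    exact_mod_cast (Finset.card_le_card hsub).trans Finset.card_biUnion_le
  refine hcard.trans ?_
  calc _ ≤ ∑ _v ∈ F, 2 ^ m * (2 * Real.exp (-(m * (3 * ε / 8) ^ 2 / (2 * R ^ 2)))) := by
        refine Finset.sum_le_sum fun v _ => ?_
        refine card_le_abs_rademacher_sum_le hR (fun i => ?_) (by positivity)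
        have h1 := hLR (w i).1 v
        have h2 := hLR (w i).2 v
        rw [abs_le]
        constructor <;> linarith [h1.1, h1.2, h2.1, h2.2]
    _ = F.card * (2 ^ m * (2 * Real.exp (-(m * (3 * ε / 8) ^ 2 / (2 * R ^ 2))))) := by simp
    _ ≤ N * (2 ^ m * (2 * Real.exp (-(m * (3 * ε / 8) ^ 2 / (2 * R ^ 2))))) := by gcongr
    _ = _ := by ring

/-- Uniform law of large numbers for a jointly measurable family of bounded functions with uniformly
bounded empirical covering numbers. The event on the left need not be measurable; its outer measure
is bounded. -/
theorem measure_pi_exists_abs_average_sub_integral_ge_le {Z U : Type*} [MeasurableSpace Z]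
    [StandardBorelSpace Z] [MeasurableSpace U] [StandardBorelSpace U] (p : Measure Z)
    [IsProbabilityMeasure p] {L : Z → U → ℝ} (hL : Measurable fun q : Z × U => L q.1 q.2)
    {c R ε : ℝ} (hR : 0 < R) (hε : 0 < ε) (hLR : ∀ z u, L z u ∈ Set.Icc c (c + R)) {m N : ℕ}
    (hm : 2 * R ^ 2 ≤ m * ε ^ 2)
    (hcover : ∀ w : Fin m → Z × Z, ∃ F : Finset U, F.card ≤ N ∧ ∀ u, ∃ v ∈ F,
      ∑ i, (|L (w i).1 v - L (w i).1 u| + |L (w i).2 v - L (w i).2 u|) ≤ m * (ε / 8)) :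
    (Measure.pi fun _ : Fin m => p) {z | ∃ u, m * ε ≤ |∑ i, L (z i) u - m * ∫ x, L x u ∂p|} ≤
      ENNReal.ofReal (4 * N * Real.exp (-(m * (3 * ε / 8) ^ 2 / (2 * R ^ 2)))) := by
  classical
  have hm0 : 0 < m := by
    rcases Nat.eq_zero_or_pos m with rfl | h
    · norm_num at hm; nlinarith
    · exact h
  set μ : Measure (Fin m → Z) := Measure.pi fun _ => p
  set ν : Measure (Fin m → Z × Z) := Measure.pi fun _ => p.prod p
  set S : Set ((Fin m → Z × Z) × U) :=
    {q | m * (ε / 2) ≤ |∑ i, (L (q.1 i).1 q.2 - L (q.1 i).2 q.2)|} with hS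
  set B : Set ((Fin m → Z) × (Fin m → Z)) :=
    {q | ∃ u, m * (ε / 2) ≤ |∑ i, (L (q.1 i) u - L (q.2 i) u)|} with hB
  have hsymm : μ {z | ∃ u, m * ε ≤ |∑ i, L (z i) u - m * ∫ x, L x u ∂p|} ≤
      2 * (μ.prod μ) B := by
    refine measure_le_two_mul_of_forall_fiber μ fun z ⟨u, hu⟩ => ?_
    have hLu : Measurable fun x => L x u := hL.comp (measurable_id.prodMk measurable_const)
    set G : Set (Fin m → Z) := {z | m * (ε / 2) ≤ |∑ i, L (z i) u - m * ∫ x, L x u ∂p|} with hG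
    have hGm : MeasurableSet G := by
      refine measurableSet_le measurable_const (Measurable.abs ?_)
      exact (Finset.measurable_fun_sum _ fun i _ => hLu.comp (measurable_pi_apply i)).sub_const _
    have hG2 : μ G ≤ 1 / 2 := measure_pi_abs_average_sub_integral_ge_le_half p hLu
      (fun x => hLR x u) (half_pos hε) (by linarith) hm0
    refine ⟨Gᶜ, ?_, fun z' hz' => ⟨u, ?_⟩⟩
    · rw [prob_compl_eq_one_sub hGm]
      refine ENNReal.le_sub_of_add_le_left (by simp [μ]) ?_
      calc μ G + 1 / 2 ≤ 1 / 2 + 1 / 2 := by gcongr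
        _ = 1 := ENNReal.add_halves 1
    · have hz'' : |∑ i, L (z' i) u - m * ∫ x, L x u ∂p| < m * (ε / 2) := not_le.1 hz'
      have := abs_sub_abs_le_abs_sub (∑ i, L (z i) u - m * ∫ x, L x u ∂p)
        (∑ i, L (z' i) u - m * ∫ x, L x u ∂p)
      rw [sub_sub_sub_cancel_right, ← Finset.sum_sub_distrib] at this
      change m * (ε / 2) ≤ |∑ i, (L (z i) u - L (z' i) u)|
      linarith
  have hmp := measurePreserving_arrowProdEquivProdArrow Z Z (Fin m) (fun _ => p) (fun _ => p)
  have hBν : (μ.prod μ) B = ν (Prod.fst '' S) := by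
    rw [← hmp.measure_preimage_equiv B]
    congr 1
    ext w
    simp [hB, hS, MeasurableEquiv.arrowProdEquivProdArrow, Equiv.arrowProdEquivProdArrow]
  have hSm : MeasurableSet S := by
    refine measurableSet_le measurable_const (Measurable.abs ?_)
    refine Finset.measurable_fun_sum _ fun i _ => ?_
    have h1 : Measurable fun q : (Fin m → Z × Z) × U => q.1 i :=
      (measurable_pi_apply i).comp measurable_fst
    exact (hL.comp (h1.fst.prodMk measurable_snd)).sub (hL.comp (h1.snd.prodMk measurable_snd))
  -- `Prod.fst '' S` is only analytic, so the swapping argument is run on a measurable subset `K`.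
  have hproj : ν (Prod.fst '' S) ≤
      ENNReal.ofReal (N * (2 * Real.exp (-(m * (3 * ε / 8) ^ 2 / (2 * R ^ 2))))) := by
    by_contra! hlt
    obtain ⟨K, hKS, hK, hlt'⟩ := hSm.exists_measurableSet_lt_image_fst ν hlt
    refine hlt'.not_ge (measure_le_of_forall_card_swapPairs_le p hK fun w => ?_)
    obtain ⟨F, hFN, hF⟩ := hcover w
    refine le_trans ?_ (card_swapPairs_exists_le hR hε hLR hFN hF)
    refine Nat.cast_le.2 (Finset.card_le_card fun s hs => ?_)
    obtain ⟨⟨w', u⟩, hq, hw'⟩ := hKS (Finset.mem_filter.1 hs).2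
    refine Finset.mem_filter.2 ⟨Finset.mem_univ _, u, ?_⟩
    rw [← show w' = swapPairs s w from hw']
    exact hq
  calc _ ≤ 2 * (μ.prod μ) B := hsymm
    _ ≤ 2 * ENNReal.ofReal (N * (2 * Real.exp (-(m * (3 * ε / 8) ^ 2 / (2 * R ^ 2))))) := by
        rw [hBν]; gcongr
    _ = _ := by
        rw [show (2 : ENNReal) = ENNReal.ofReal 2 by simp, ← ENNReal.ofReal_mul (by norm_num)]
        ring_nf

/-! ### The softmax loss -/

namespace SecurityGame

theorem loss_eq {T : ℕ} (i : Fin T) (a : Fin (T - 1) → ℝ) :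
    loss i a = Real.log (1 + ∑ j, Real.exp (a j)) - extend a i := by
  have : 0 < 1 + ∑ j, Real.exp (a j) := by positivity
  rw [loss, Real.log_div (Real.exp_pos _).ne' this.ne', Real.log_exp]
  ring

theorem loss_nonneg {T : ℕ} (i : Fin T) (a : Fin (T - 1) → ℝ) : 0 ≤ loss i a := by
  rw [loss_eq, sub_nonneg, Real.le_log_iff_exp_le (by positivity), extend]
  split_ifs with hi
  · have := Finset.single_le_sum (f := fun j => Real.exp (a j)) (fun _ _ => (Real.exp_pos _).le)
      (Finset.mem_univ ⟨i, hi⟩)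
    linarith
  · rw [Real.exp_zero]
    have : 0 ≤ ∑ j, Real.exp (a j) := by positivity
    linarith

/-- Log-sum-exp (with a constant summand `exp 0`) is nonexpansive for the sup distance. -/
theorem log_one_add_sum_exp_le {n : ℕ} {a b : Fin n → ℝ} {s : ℝ} (hs : 0 ≤ s)
    (h : ∀ i, a i ≤ b i + s) :
    Real.log (1 + ∑ j, Real.exp (a j)) ≤ Real.log (1 + ∑ j, Real.exp (b j)) + s := by
  have hb : 0 < 1 + ∑ j, Real.exp (b j) := by positivity
  rw [← Real.log_exp s, ← Real.log_mul hb.ne' (Real.exp_pos _).ne']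
  refine Real.log_le_log (by positivity) ?_
  rw [add_mul, one_mul, Finset.sum_mul]
  refine add_le_add (Real.one_le_exp hs) (Finset.sum_le_sum fun j _ => ?_)
  rw [← Real.exp_add]
  exact Real.exp_le_exp.2 (h j)

theorem abs_extend_sub_extend_le {T : ℕ} {a b : Fin (T - 1) → ℝ} {s : ℝ} (hs : 0 ≤ s)
    (h : ∀ i, |a i - b i| ≤ s) (y : Fin T) : |extend a y - extend b y| ≤ s := by
  unfold extend
  split_ifs with hi
  · exact h _
  · simpa using hs

theorem abs_loss_sub_loss_le {T : ℕ} {a b : Fin (T - 1) → ℝ} {s : ℝ} (hs : 0 ≤ s)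
    (h : ∀ i, |a i - b i| ≤ s) (y : Fin T) : |loss y a - loss y b| ≤ 2 * s := by
  have h1 := log_one_add_sum_exp_le (a := a) (b := b) hs fun i => by linarith [(abs_le.1 (h i)).2]
  have h2 := log_one_add_sum_exp_le (a := b) (b := a) hs fun i => by linarith [(abs_le.1 (h i)).1]
  have h3 := abs_le.1 (abs_extend_sub_extend_le hs h y)
  rw [loss_eq, loss_eq, abs_le]
  constructor <;> linarith [h3.1, h3.2]

theorem abs_sub_le_iSup {n : ℕ} (a b : Fin n → ℝ) (i : Fin n) :
    |a i - b i| ≤ ⨆ j, |a j - b j| :=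
  le_ciSup (f := fun j => |a j - b j|) (Set.finite_range _).bddAbove i

theorem iSup_abs_sub_nonneg {n : ℕ} (a b : Fin n → ℝ) : 0 ≤ ⨆ j, |a j - b j| :=
  Real.iSup_nonneg fun _ => abs_nonneg _

theorem rho_le_two_mul_iSup (T : ℕ) (a b : Fin (T - 1) → ℝ) :
    rho T a b ≤ 2 * ⨆ i, |a i - b i| :=
  Real.iSup_le (fun y => abs_loss_sub_loss_le (iSup_abs_sub_nonneg a b) (abs_sub_le_iSup a b) y)
    (mul_nonneg zero_le_two (iSup_abs_sub_nonneg a b))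

theorem avgL1_nonneg {n : ℕ} (a b : Fin n → ℝ) : 0 ≤ avgL1 a b := by
  unfold avgL1; positivity

theorem iSup_abs_sub_le_mul_avgL1 (T : ℕ) (a b : Fin (T - 1) → ℝ) :
    ⨆ i, |a i - b i| ≤ T * avgL1 a b := by
  refine Real.iSup_le (fun i => ?_) (mul_nonneg T.cast_nonneg (avgL1_nonneg a b))
  have hn : ((T - 1 : ℕ) : ℝ) ≠ 0 := by
    have := i.pos
    exact_mod_cast this.ne'
  calc |a i - b i| ≤ ∑ j, |a j - b j| :=
        Finset.single_le_sum (f := fun j => |a j - b j|) (fun _ _ => abs_nonneg _)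
          (Finset.mem_univ i)
    _ = ((T - 1 : ℕ) : ℝ) * avgL1 a b := by rw [avgL1]; field_simp
    _ ≤ T * avgL1 a b :=
        mul_le_mul_of_nonneg_right (Nat.cast_le.2 (Nat.sub_le T 1)) (avgL1_nonneg a b)

theorem abs_loss_sub_loss_le_avgL1 {T : ℕ} (y : Fin T) (a b : Fin (T - 1) → ℝ) :
    |loss y a - loss y b| ≤ 2 * T * avgL1 a b := by
  have := abs_loss_sub_loss_le (iSup_abs_sub_nonneg a b) (abs_sub_le_iSup a b) y
  linarith [iSup_abs_sub_le_mul_avgL1 T a b]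

/-- The range of the loss on the box `[-M/2, M/2]^(T-1)` has length at most `2 M`; it is centred at
the log-sum-exp of the zero vector. -/
theorem loss_mem_Icc {T : ℕ} {M : ℝ} (hM : 0 ≤ M) {a : Fin (T - 1) → ℝ}
    (ha : ∀ i, a i ∈ Set.Icc (-(M / 2)) (M / 2)) (y : Fin T) :
    loss y a ∈ Set.Icc (loss y 0 - M) (loss y 0 - M + 2 * M) := by
  have h := abs_le.1 (abs_loss_sub_loss_le (a := a) (b := 0) (s := M / 2) (by linarith) (fun i => by
    simpa [abs_le] using ha i) y)
  constructor <;> linarith [h.1, h.2]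

theorem loss_zero {T : ℕ} (y : Fin T) :
    loss y (0 : Fin (T - 1) → ℝ) = Real.log (1 + (T - 1 : ℕ)) := by
  rw [loss_eq]
  simp [extend]

theorem measurable_loss (T : ℕ) :
    Measurable fun q : Fin T × (Fin (T - 1) → ℝ) => loss q.1 q.2 := by
  refine measurable_from_prod_countable_right fun i => ?_
  simp only [loss_eq]
  refine Measurable.sub (by fun_prop) ?_
  unfold extend
  split_ifs <;> fun_prop

/-! ### Capacity, permissibility and uniform convergence -/

theorem exists_finset_isCover {X A : Type*} [MeasurableSpace X] {ε : ℝ} {H : Set (X → A)}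
    {d : A → A → ℝ} (hcap : capacity ε H d ≠ ⊤) (P : Measure X) [IsProbabilityMeasure P] :
    ∃ F : Finset (X → A), IsCover ε H (distL1 P d) F ∧ F.card ≤ (capacity ε H d).toNat := by
  have h1 : coveringNumber ε H (distL1 P d) ≤ capacity ε H d :=
    le_iSup (fun P : ProbabilityMeasure X => coveringNumber ε H (distL1 (P : Measure X) d))
      ⟨P, inferInstance⟩
  rw [← ENat.natCast_toNat hcap] at h1
  have h2 : coveringNumber ε H (distL1 P d) < (((capacity ε H d).toNat + 1 : ℕ) : ℕ∞) :=
    h1.trans_lt (by exact_mod_cast Nat.lt_succ_self _)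
  rw [coveringNumber, iInf_lt_iff] at h2
  obtain ⟨F, hF⟩ := h2
  obtain ⟨hF1, hF2⟩ := iInf_lt_iff.1 hF
  exact ⟨F, hF1, Nat.lt_succ_iff.1 (by exact_mod_cast hF2)⟩

/-- A finite capacity yields covers in the `L¹` distance of any finite double sample, since the
supremum over all probability measures includes empirical ones. -/
theorem exists_finset_forall_sum_le {X A : Type*} [MeasurableSpace X]
    [MeasurableSingletonClass X] {ε : ℝ} {H : Set (X → A)} {d : A → A → ℝ}
    (hcap : capacity ε H d ≠ ⊤) {m : ℕ} (hm : 0 < m) (x : Fin m → X × X) :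
    ∃ F : Finset (X → A), F.card ≤ (capacity ε H d).toNat ∧ (F : Set (X → A)) ⊆ H ∧
      ∀ h ∈ H, ∃ f ∈ F,
        ∑ i, (d (f (x i).1) (h (x i).1) + d (f (x i).2) (h (x i).2)) ≤ 2 * m * ε := by
  set P : Measure X := ENNReal.ofReal (1 / (2 * m)) •
    ∑ i, (Measure.dirac (x i).1 + Measure.dirac (x i).2) with hP
  have hm' : (0 : ℝ) < m := by exact_mod_cast hm
  have hprob : IsProbabilityMeasure P := by
    constructor
    simp only [hP, Measure.smul_apply, Measure.finsetSum_apply, Measure.add_apply, measure_univ,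
      smul_eq_mul, Finset.sum_const, Finset.card_univ, Fintype.card_fin, nsmul_eq_mul]
    rw [show (m : ENNReal) * (1 + 1) = ENNReal.ofReal (2 * m) by
      rw [ENNReal.ofReal_mul (by norm_num)]; simp [mul_comm, one_add_one_eq_two],
      ← ENNReal.ofReal_mul (by positivity), one_div_mul_cancel (by positivity), ENNReal.ofReal_one]
  obtain ⟨F, ⟨hFH, hF⟩, hcard⟩ := exists_finset_isCover hcap P
  refine ⟨F, hcard, hFH, fun h hh => ?_⟩
  obtain ⟨f, hfF, hf⟩ := hF h hh
  refine ⟨f, hfF, ?_⟩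
  have hint : ∀ y : X, Integrable (fun z => d (f z) (h z)) (Measure.dirac y) := fun y =>
    integrable_dirac (by simp)
  rw [distL1, hP, integral_smul_measure, integral_finsetSum_measure fun i _ =>
    (hint _).add_measure (hint _)] at hf
  simp_rw [integral_add_measure (hint _) (hint _), integral_dirac] at hf
  rw [ENNReal.toReal_ofReal (by positivity), smul_eq_mul, one_div, inv_mul_le_iff₀ (by positivity)]
    at hf
  exact hf

/-- A nonempty permissible class is parametrized by the Polish space `ℕ → ℕ`, as its analytic index
set is a continuous image of that space. -/
theorem Permissible.exists_measurable_parametrization {X A : Type*} [MeasurableSpace X]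
    [MeasurableSpace A] {H : Set (X → A)} (hH : Permissible H) (hne : H.Nonempty) :
    ∃ F : X × (ℕ → ℕ) → A, Measurable F ∧ H = Set.range fun u x => F (x, u) := by
  obtain ⟨S, _, _, _, _, I, f, hI, hf, rfl⟩ := hH
  rw [AnalyticSet] at hI
  obtain rfl | ⟨g, hg, rfl⟩ := hI
  · obtain ⟨_, ⟨t, ht⟩, _⟩ := hne
    exact absurd ht (Set.notMem_empty t)
  have hg' : Measurable (Set.rangeFactorization g) := hg.measurable.subtype_mk
  refine ⟨fun q => f (q.1, Set.rangeFactorization g q.2),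
    hf.comp (measurable_fst.prodMk (hg'.comp measurable_snd)), ?_⟩
  exact (Set.rangeFactorization_surjective.range_comp
    (fun t x => f (x, t))).symm

/-- A bound on the outer measure of the complement suffices for `ProbGT`: take the complement of a
measurable hull. -/
theorem ProbGT.of_measure_compl_lt {Ω : Type*} [MeasurableSpace Ω] {μ : Measure Ω}
    [IsProbabilityMeasure μ] {E : Set Ω} {q : ℝ} (hq : q ≤ 1) (hE : μ Eᶜ < ENNReal.ofReal q) :
    ProbGT μ E (1 - q) := by
  refine ⟨(toMeasurable μ Eᶜ)ᶜ, (measurableSet_toMeasurable _ _).compl,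
    Set.compl_subset_comm.1 (subset_toMeasurable _ _), ?_⟩
  rw [ENNReal.ofReal_lt_iff_lt_toReal (by linarith) (measure_ne_top _ _), ← measureReal_def,
    probReal_compl_eq_one_sub (measurableSet_toMeasurable _ _), measureReal_def,
    measure_toMeasurable]
  linarith [ENNReal.toReal_lt_of_lt_ofReal hE]

theorem ProbGT.inter {Ω : Type*} [MeasurableSpace Ω] {μ : Measure Ω} [IsProbabilityMeasure μ]
    {E₁ E₂ E : Set Ω} {δ : ℝ} (hδ : δ ≤ 1) (h₁ : ProbGT μ E₁ (1 - δ / 2))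
    (h₂ : ProbGT μ E₂ (1 - δ / 2)) (hE : E₁ ∩ E₂ ⊆ E) : ProbGT μ E (1 - δ) := by
  obtain ⟨G₁, hG₁, hGE₁, hlt₁⟩ := h₁
  obtain ⟨G₂, hG₂, hGE₂, hlt₂⟩ := h₂
  refine ⟨G₁ ∩ G₂, hG₁.inter hG₂, (Set.inter_subset_inter hGE₁ hGE₂).trans hE, ?_⟩
  have hr : ∀ G : Set Ω, ∀ c : ℝ, 0 ≤ c → (ENNReal.ofReal c < μ G ↔ c < μ.real G) := fun G c hc =>
    ENNReal.ofReal_lt_iff_lt_toReal hc (measure_ne_top μ G)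
  rw [hr _ _ (by linarith)] at *
  have h1 := measureReal_union_add_inter (μ := μ) (s := G₁) hG₂
  have h2 : μ.real (G₁ ∪ G₂) ≤ 1 := measureReal_le_one
  linarith

instance {X : Type*} [MeasurableSpace X] {T : ℕ} (p : Measure (X × Fin T))
    [IsProbabilityMeasure p] (m : ℕ) : IsProbabilityMeasure (sampleLaw p m) := by
  unfold sampleLaw; infer_instance

/-- Uniform convergence, from the uniform law of large numbers with `ε = α / 3` and `R = 2 M`. A
cover at scale `α / (96 T)` for `avgL1` is one at scale `α / 48 = ε / 16` for the losses. -/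
theorem uniformConvergence_of_capacity {X : Type*} [MeasurableSpace X] [StandardBorelSpace X]
    {T : ℕ} {M : ℝ} (hM : 0 < M) {H : Set (X → Fin (T - 1) → ℝ)} (hperm : Permissible H)
    (hrange : ∀ h ∈ H, ∀ x i, h x i ∈ Set.Icc (-(M / 2)) (M / 2)) {α δ : ℝ} (hα : 0 < α)
    (hδ : 0 < δ) (hδ1 : δ < 1) (hcap : capacity (α / (96 * T)) H avgL1 ≠ ⊤) {m : ℕ}
    (hm : 576 * M ^ 2 / α ^ 2 * (Real.log (1 / δ) + Real.log
      (8 * ((capacity (α / (96 * T)) H avgL1).toNat : ℝ))) ≤ m)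
    (p : Measure (X × Fin T)) [IsProbabilityMeasure p] : UniformConvergence H p m α δ := by
  rcases H.eq_empty_or_nonempty with rfl | hne
  · refine ⟨Set.univ, MeasurableSet.univ, by simp, ?_⟩
    rw [measure_univ, ENNReal.ofReal_lt_one]
    linarith
  obtain ⟨Φ, hΦ, rfl⟩ := hperm.exists_measurable_parametrization hne
  set H : Set (X → Fin (T - 1) → ℝ) := Set.range fun u x => Φ (x, u) with hHdef
  set N := (capacity (α / (96 * T)) H avgL1).toNat with hN
  obtain ⟨z₀⟩ : Nonempty (X × Fin T) := p.nonempty_of_neZero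
  have hT : (0 : ℝ) < T := by exact_mod_cast z₀.2.pos
  have hN1 : 1 ≤ N := by
    obtain ⟨F, hF, hcard⟩ := exists_finset_isCover hcap (Measure.dirac z₀.1)
    obtain ⟨h, hh⟩ := hne
    obtain ⟨f, hf, _⟩ := hF.2 h hh
    exact (Finset.card_pos.2 ⟨f, hf⟩).trans_le hcard
  have hN1' : (1 : ℝ) ≤ N := by exact_mod_cast hN1
  -- `x = log (8 N / δ)`
  set x : ℝ := Real.log (1 / δ) + Real.log (8 * (N : ℝ)) with hx
  have hxe : Real.exp x = 8 * N / δ := by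
    rw [hx, Real.exp_add, Real.exp_log (by positivity), Real.exp_log (by positivity)]
    ring
  have hx1 : 1 ≤ x := by
    have h1 : 0 ≤ Real.log (1 / δ) := Real.log_nonneg (by rw [le_div_iff₀ hδ]; linarith)
    have h2 : 1 ≤ Real.log (8 * (N : ℝ)) := by
      rw [Real.le_log_iff_exp_le (by positivity)]
      linarith [Real.exp_one_lt_d9]
    linarith
  have hm2 : 576 * M ^ 2 * x ≤ m * α ^ 2 := by
    rwa [div_mul_eq_mul_div, div_le_iff₀ (by positivity)] at hm
  have hm0 : 0 < m := by
    rcases Nat.eq_zero_or_pos m with rfl | h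
    · have : 0 < 576 * M ^ 2 * x := by positivity
      norm_num at hm2; linarith
    · exact h
  have hm0' : (0 : ℝ) < m := by exact_mod_cast hm0
  let L : X × Fin T → (ℕ → ℕ) → ℝ := fun z u => loss z.2 (Φ (z.1, u))
  have hL : Measurable fun q : (X × Fin T) × (ℕ → ℕ) => L q.1 q.2 :=
    (measurable_loss T).comp
      (measurable_fst.snd.prodMk (hΦ.comp (measurable_fst.fst.prodMk measurable_snd)))
  have hLR : ∀ z u, L z u ∈ Set.Icc (Real.log (1 + (T - 1 : ℕ)) - M)
      (Real.log (1 + (T - 1 : ℕ)) - M + 2 * M) := fun z u => by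
    rw [← loss_zero z.2]
    exact loss_mem_Icc hM.le (hrange _ ⟨u, rfl⟩ z.1) z.2
  have hcover : ∀ w : Fin m → (X × Fin T) × (X × Fin T), ∃ F : Finset (ℕ → ℕ), F.card ≤ N ∧
      ∀ u, ∃ v ∈ F, ∑ i, (|L (w i).1 v - L (w i).1 u| + |L (w i).2 v - L (w i).2 u|) ≤
        m * (α / 3 / 8) := by
    classical
    intro w
    obtain ⟨F, hcard, hFH, hF⟩ :=
      exists_finset_forall_sum_le hcap hm0 fun i => ((w i).1.1, (w i).2.1)
    choose! σ hσ using fun f (hf : f ∈ H) => hf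
    refine ⟨F.image σ, Finset.card_image_le.trans hcard, fun u => ?_⟩
    obtain ⟨f, hf, hsum⟩ := hF _ ⟨u, rfl⟩
    refine ⟨σ f, Finset.mem_image_of_mem σ hf, ?_⟩
    have hσf : ∀ x, Φ (x, σ f) = f x := fun x => congrFun (hσ f (hFH hf)) x
    calc _ ≤ ∑ i, (2 * T * avgL1 (f (w i).1.1) (Φ ((w i).1.1, u)) +
            2 * T * avgL1 (f (w i).2.1) (Φ ((w i).2.1, u))) := by
          refine Finset.sum_le_sum fun i _ => ?_
          simp only [L, hσf]
          exact add_le_add (abs_loss_sub_loss_le_avgL1 _ _ _) (abs_loss_sub_loss_le_avgL1 _ _ _)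
      _ = 2 * T * ∑ i, (avgL1 (f (w i).1.1) (Φ ((w i).1.1, u)) +
            avgL1 (f (w i).2.1) (Φ ((w i).2.1, u))) := by
          rw [Finset.mul_sum]; simp_rw [mul_add]
      _ ≤ 2 * T * (2 * m * (α / (96 * T))) := by gcongr
      _ = m * (α / 3 / 8) := by field_simp; norm_num
  have hbound := measure_pi_exists_abs_average_sub_integral_ge_le p hL
    (by positivity : 0 < 2 * M) (by positivity : 0 < α / 3) hLR (m := m) (N := N)
    (by nlinarith) hcover
  -- The exponent is `m α² / (512 M²)`, which exceeds `x` strictly because `512 < 576`.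
  have hexp : 4 * N * Real.exp (-(m * (3 * (α / 3) / 8) ^ 2 / (2 * (2 * M) ^ 2))) < δ / 2 := by
    have h1 : x < m * (3 * (α / 3) / 8) ^ 2 / (2 * (2 * M) ^ 2) := by
      rw [lt_div_iff₀ (by positivity)]
      nlinarith [mul_pos (pow_pos hM 2) (one_pos.trans_le hx1)]
    calc _ < 4 * N * Real.exp (-x) := by gcongr
      _ = δ / 2 := by rw [Real.exp_neg, hxe]; field_simp; norm_num
  refine ProbGT.of_measure_compl_lt (by linarith) (lt_of_le_of_lt ?_
    ((ENNReal.ofReal_lt_ofReal_iff (by positivity)).2 hexp))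
  refine le_trans (measure_mono fun z hz => ?_) hbound
  obtain ⟨u, hu⟩ : ∃ u, α / 3 ≤ |empRisk z (fun x => Φ (x, u)) - trueRisk p fun x => Φ (x, u)| := by
    simpa [hHdef] using hz
  refine ⟨u, ?_⟩
  have hmul : ∑ i, L (z i) u - m * ∫ x, L x u ∂p =
      m * (empRisk z (fun x => Φ (x, u)) - trueRisk p fun x => Φ (x, u)) := by
    simp only [empRisk, trueRisk, L]
    field_simp
  rw [hmul, abs_mul, abs_of_pos hm0']
  gcongr

/-! ### Empirical risk minimization -/

theorem empRisk_nonneg {X : Type*} {T m : ℕ} (z : Fin m → X × Fin T)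
    (h : X → Fin (T - 1) → ℝ) : 0 ≤ empRisk z h :=
  mul_nonneg (by positivity) (Finset.sum_nonneg fun _ _ => loss_nonneg _ _)

theorem trueRisk_nonneg {X : Type*} [MeasurableSpace X] {T : ℕ} (p : Measure (X × Fin T))
    (h : X → Fin (T - 1) → ℝ) : 0 ≤ trueRisk p h :=
  integral_nonneg fun _ => loss_nonneg _ _

/-- If all empirical values are within `ε` of the true ones, then a point that nearly minimizes the
empirical values nearly minimizes the true ones. -/
theorem abs_sub_sInf_image_lt {B : Type*} {H : Set B} {r r' : B → ℝ} {ε : ℝ} {h₀ : B}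
    (h₀H : h₀ ∈ H) (hr : ∀ h, 0 ≤ r h) (hr' : ∀ h, 0 ≤ r' h)
    (hunif : ∀ h ∈ H, |r' h - r h| < ε) (hmin : |r' h₀ - sInf (r' '' H)| < ε) :
    |r h₀ - sInf (r '' H)| < 3 * ε := by
  have hbdd : ∀ g : B → ℝ, (∀ h, 0 ≤ g h) → BddBelow (g '' H) := fun g hg =>
    ⟨0, by rintro _ ⟨h, _, rfl⟩; exact hg h⟩
  have h1 : sInf (r '' H) ≤ r h₀ := csInf_le (hbdd r hr) (Set.mem_image_of_mem r h₀H)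
  have h2 : sInf (r' '' H) - ε ≤ sInf (r '' H) := by
    refine le_csInf ⟨_, Set.mem_image_of_mem r h₀H⟩ ?_
    rintro _ ⟨h, hh, rfl⟩
    have := csInf_le (hbdd r' hr') (Set.mem_image_of_mem r' hh)
    linarith [(abs_lt.1 (hunif h hh)).2]
  rw [abs_of_nonneg (sub_nonneg.2 h1)]
  linarith [(abs_lt.1 (hunif h₀ h₀H)).1, (abs_lt.1 hmin).2]

theorem IsERM.isApproxERM {X : Type*} [MeasurableSpace X] {T m : ℕ}
    {H : Set (X → Fin (T - 1) → ℝ)} {alg : Algorithm X T m} (halg : IsERM H alg)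
    (p : Measure (X × Fin T)) [IsProbabilityMeasure p] {α δ : ℝ} (hα : 0 < α) (hδ : 0 < δ) :
    IsApproxERM H p α δ alg := by
  refine ⟨fun z => (halg z).1, Set.univ, MeasurableSet.univ, fun z _ => ?_, ?_⟩
  · simp only [Set.mem_ofPred_eq, (halg z).2, sub_self, abs_zero]
    positivity
  · rw [measure_univ, ENNReal.ofReal_lt_one]
    linarith

theorem IsApproxERM.pacGuarantee {X : Type*} [MeasurableSpace X] {T m : ℕ}
    {H : Set (X → Fin (T - 1) → ℝ)} {alg : Algorithm X T m} {p : Measure (X × Fin T)}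
    [IsProbabilityMeasure p] {α δ : ℝ} (halg : IsApproxERM H p α δ alg)
    (hunif : UniformConvergence H p m α δ) (hδ1 : δ ≤ 1) :
    PACGuarantee H p α δ alg := by
  refine ProbGT.inter hδ1 hunif halg.2 fun z hz => ?_
  have := abs_sub_sInf_image_lt (halg.1 z) (trueRisk_nonneg p) (empRisk_nonneg z) hz.1 hz.2
  rwa [mul_div_cancel₀ α (by norm_num : (3 : ℝ) ≠ 0)] at this

end SecurityGame

theorem theorem1 {X : Type*} [MeasurableSpace X] [StandardBorelSpace X]
    (T : ℕ) (M : ℝ) (hM : 0 < M)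
    (H : Set (X → Fin (T - 1) → ℝ)) (hperm : SecurityGame.Permissible H)
    (hrange : ∀ h ∈ H, ∀ x i, h x i ∈ Set.Icc (-(M / 2)) (M / 2)) :
    (∀ a b : Fin (T - 1) → ℝ,
      SecurityGame.rho T a b ≤ 2 * (⨆ i, |a i - b i|) ∧
      2 * (⨆ i, |a i - b i|) ≤ 2 * (T : ℝ) * SecurityGame.avgL1 a b) ∧
    ∀ α δ : ℝ, 0 < α → 0 < δ → δ < 1 →
      SecurityGame.capacity (α / (96 * T)) H SecurityGame.avgL1 ≠ ⊤ →
      ∀ m : ℕ,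
        576 * M ^ 2 / α ^ 2 * (Real.log (1 / δ) + Real.log
          (8 * ((SecurityGame.capacity (α / (96 * T)) H SecurityGame.avgL1).toNat : ℝ))) ≤ m →
        ∀ (p : MeasureTheory.Measure (X × Fin T)) [MeasureTheory.IsProbabilityMeasure p],
          SecurityGame.UniformConvergence H p m α δ ∧
          (∀ alg : SecurityGame.Algorithm X T m, SecurityGame.IsERM H alg →
            SecurityGame.IsApproxERM H p α δ alg) ∧
          (∀ alg : SecurityGame.Algorithm X T m, SecurityGame.IsApproxERM H p α δ alg →
            SecurityGame.PACGuarantee H p α δ alg) ∧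
          ((∃ alg : SecurityGame.Algorithm X T m, SecurityGame.IsERM H alg) →
            SecurityGame.PACLearnable H p m α δ) := by
  refine ⟨fun a b => ⟨SecurityGame.rho_le_two_mul_iSup T a b, ?_⟩, ?_⟩
  · linarith [SecurityGame.iSup_abs_sub_le_mul_avgL1 T a b]
  intro α δ hα hδ hδ1 hcap m hm p _
  have hunif := SecurityGame.uniformConvergence_of_capacity hM hperm hrange hα hδ hδ1 hcap hm p
  exact ⟨hunif, fun alg halg => halg.isApproxERM p hα hδ,
    fun alg halg => halg.pacGuarantee hunif hδ1.le,
    fun ⟨alg, halg⟩ => ⟨alg, halg, hunif, halg.isApproxERM p hα hδ⟩⟩
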